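/- **Definitions.** All graphs are finite and simple, and $\mathrm{pm}(G)$ denotes the number of perfect matchings of $G$ (so $\mathrm{pm}(\emptyset)=1$). For a graph $G$, let $D(G)$ be the set of vertices left unmatched by at least one maximum matching of $G$, $A(G)$ the set of vertices outside $D(G)$ with a neighbour in $D(G)$, and $C(G)=V(G)\setminus(D(G)\cup A(G))$. A real number $a$ estimates $z\ge 0$ to within accuracy $\varepsilon$ if $(1-\varepsilon)z\le a\le(1+\varepsilon)z$. The permanent of a bipartite graph on $(X,Y)$ with edge weights $w\ge 0$ (weight $0$ for non-edges) is $\operatorname{per}(w)=\sum_{\sigma}\prod_{x\in X}w(x,\sigma(x))$, the sum being over all bijections $\sigma:X\to Y$ (so it is $0$ if $|X|\ne|Y|$). For a vertex $u$ of $G$, let $X=A(G-u)\cup\{u\}$, let $Y$ be the set of connected components of the subgraph of $G-u$ induced on $D(G-u)$, and for $v\in D(G-u)$ let $H_v\in Y$ be the component containing $v$. For numbers $m_v$ $(v\in D(G-u))$, put $w_m(x,H)=\sum_{v\in N_G(x)\cap H}m_v$ for $x\in X$, $H\in Y$. Let $\textsc{Permanent}$ be a (possibly randomized) subroutine which, for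 every finite bipartite graph with nonnegative edge weights and every $0<\delta\le 1$, returns a value, every value it may return being an estimate of the permanent to within accuracy $\delta$. The procedure $\textsc{Recursive-Count}(G,\varepsilon)$ is as follows. If $V(G)=\emptyset$, return $1$. Otherwise choose any $u\in V(G)$; let $n=|V(G)|$; for every $v\in D(G-u)$ let $m_v$ be the result of $\textsc{Recursive-Count}(H_v-v,\varepsilon/(2n))$; let $m_C$ be the result of $\textsc{Recursive-Count}$ on the subgraph induced on $C(G-u)$ with accuracy $\varepsilon/3$; return $m_C\cdot\textsc{Permanent}(w_m,\varepsilon/3)$. **Theorem.** Let $G$ be a finite graph. 1. For every vertex $u$ of $G$, with the exact counts $m_v=\mathrm{pm}(H_v-v)$, $$\mathrm{pm}\big(G[C(G-u)]\big)\cdot\operatorname{per}(w_m)=\mathrm{pm}(G).$$ 2. For every such subroutine, every rule for choosing the vertices $u$, and every $0<\varepsilon\le 1$, $\textsc{Recursive-Count}(G,\varepsilon)$ returns a value, and every value it may return estimates $\mathrm{pm}(G)$ to within accuracy $\varepsilon$. -/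

import Mathlib

universe u

namespace RecCount

/-- The number of perfect matchings of `G`. -/
noncomputable def numPM {V : Type u} (G : SimpleGraph V) : ℕ :=
  Nat.card {M : G.Subgraph // M.IsPerfectMatching}

/-- A matching with the largest number of edges. -/
def IsMaximumMatching {V : Type u} {G : SimpleGraph V} (M : G.Subgraph) : Prop :=
  M.IsMatching ∧ ∀ M' : G.Subgraph, M'.IsMatching → M'.edgeSet.ncard ≤ M.edgeSet.ncard

/-- `D(G)`: the vertices left unmatched by at least one maximum matching. -/
def geD {V : Type u} (G : SimpleGraph V) : Set V :=
  {v | ∃ M : G.Subgraph, IsMaximumMatching M ∧ v ∉ M.verts}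

/-- `A(G)`: the vertices outside `D(G)` with a neighbour in `D(G)`. -/
def geA {V : Type u} (G : SimpleGraph V) : Set V :=
  {v | v ∉ geD G ∧ ∃ w ∈ geD G, G.Adj v w}

/-- `C(G)`: the remaining vertices. -/
def geC {V : Type u} (G : SimpleGraph V) : Set V :=
  {v | v ∉ geD G ∧ v ∉ geA G}

/-- `G - u`. -/
abbrev del {V : Type u} (G : SimpleGraph V) (u : V) : SimpleGraph ({u}ᶜ : Set V) :=
  G.induce {u}ᶜ

/-- The subgraph of `G - u` induced on `D(G - u)`. -/
abbrev dGraph {V : Type u} (G : SimpleGraph V) (u : V) : SimpleGraph (geD (del G u)) :=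
  (del G u).induce (geD (del G u))

/-- The subgraph of `G - u` induced on `C(G - u)`. -/
abbrev cGraph {V : Type u} (G : SimpleGraph V) (u : V) : SimpleGraph (geC (del G u)) :=
  (del G u).induce (geC (del G u))

/-- `H_v - v`, where `H_v` is the connected component of `D(G - u)` containing `v`. -/
abbrev hGraph {V : Type u} (G : SimpleGraph V) (u : V) (v : geD (del G u)) :
    SimpleGraph (((dGraph G u).connectedComponentMk v).supp \ {v} : Set (geD (del G u))) :=
  (dGraph G u).induce (((dGraph G u).connectedComponentMk v).supp \ {v})

/-- `X = A(G - u) ∪ {u}`, as a set of vertices of `G`. -/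
abbrev leftSide {V : Type u} (G : SimpleGraph V) (u : V) : Set V :=
  insert u (Subtype.val '' geA (del G u))

/-- `Y`: the connected components of `D(G - u)`. -/
abbrev rightSide {V : Type u} (G : SimpleGraph V) (u : V) : Type u :=
  (dGraph G u).ConnectedComponent

/-- The edge weights `w(x, H) = ∑_{v ∈ N(x) ∩ H} m_v` of the bipartite graph on `(X, Y)`;
the weight is `0` where there is no edge. -/
noncomputable def weight {V : Type u} (G : SimpleGraph V) (u : V) (m : geD (del G u) → ℝ)
    (x : leftSide G u) (H : rightSide G u) : ℝ :=
  ∑ᶠ (v : geD (del G u))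
    (_ : (dGraph G u).connectedComponentMk v = H ∧ G.Adj (x : V) ((v : ({u}ᶜ : Set V)) : V)), m v

/-- The permanent of a weighted bipartite graph on `(X, Y)`: the total weight of its perfect
matchings, which is `0` if the two sides have different sizes. -/
noncomputable def permanent {X Y : Type u} (w : X → Y → ℝ) : ℝ :=
  ∑ᶠ σ : X ≃ Y, ∏ᶠ x, w x (σ x)

/-- `a` estimates `z` to within (relative) accuracy `ε`: `(1 - ε) z ≤ a ≤ (1 + ε) z`. -/
def Within (ε a z : ℝ) : Prop :=
  (1 - ε) * z ≤ a ∧ a ≤ (1 + ε) * z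

/-- A subroutine that is called with a weighted bipartite graph and an accuracy; its value is the
set of possible return values (several, if it is randomized). -/
abbrev Subroutine : Type (u + 1) :=
  ∀ X Y : Type u, (X → Y → ℝ) → ℝ → Set ℝ

/-- The subroutine computes permanents of nonnegatively weighted finite bipartite graphs: it
returns a value, and every value it may return is within the requested accuracy. -/
def Subroutine.ComputesPermanent (P : Subroutine.{u}) : Prop :=
  ∀ (X Y : Type u) [Finite X] [Finite Y] (w : X → Y → ℝ) (ε : ℝ),
    (∀ x y, 0 ≤ w x y) → 0 < ε → ε ≤ 1 →
      (P X Y w ε).Nonempty ∧ ∀ p ∈ P X Y w ε, Within ε p (permanent w)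

/-- A rule for the choice of `u`: the set of vertices that may be chosen in the call with
a given graph and accuracy. -/
abbrev ChoiceRule : Type (u + 1) :=
  ∀ V : Type u, SimpleGraph V → ℝ → Set V

/-- The rule offers a vertex in every nonempty finite graph. -/
def ChoiceRule.Total (U : ChoiceRule.{u}) : Prop :=
  ∀ (V : Type u) [Finite V] [Nonempty V] (G : SimpleGraph V) (ε : ℝ), (U V G ε).Nonempty

/-- `Returns P U G ε r`: the recursive algorithm, called with `(G, ε)`, may return `r`, when it
uses the subroutine `P` for permanents and the rule `U` for choosing the vertex `u`. -/
inductive Returns (P : Subroutine.{u}) (U : ChoiceRule.{u}) :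
    ∀ {V : Type u}, SimpleGraph V → ℝ → ℝ → Prop
  | empty {V : Type u} [IsEmpty V] (G : SimpleGraph V) (ε : ℝ) : Returns P U G ε 1
  | step {V : Type u} (G : SimpleGraph V) (ε : ℝ) (u : V) (hu : u ∈ U V G ε)
      (m : geD (del G u) → ℝ)
      (hm : ∀ v, Returns P U (hGraph G u v) (ε / (2 * (Nat.card V : ℝ))) (m v))
      (mC : ℝ) (hC : Returns P U (cGraph G u) (ε / 3) mC)
      (p : ℝ) (hp : p ∈ P (leftSide G u) (rightSide G u) (weight G u m) (ε / 3)) :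
      Returns P U G ε (mC * p)

end RecCount

/-!
By the Gallai–Edmonds structure theory, the restriction of a perfect matching of `G` to `G - u` is a
maximum matching, which matches `A(G - u)` into `D(G - u)` and leaves exactly one vertex of each
component of `D(G - u)` unmatched or matched into `A(G - u)`. A perfect matching of `G` thus
consists of a transversal of the components, matched with `A(G - u) ∪ {u}`, a perfect matching of
each `H_v - v`, and a perfect matching of `C(G - u)`. Expanding the permanent over transversals
gives the identity.

For the error analysis, components with a single vertex contribute an exact factor `1`, and each
other component takes up at least three vertices of `G` together with its partner in `X`. Each term
of the permanent therefore has at most `n / 3` inexact factors of accuracy `ε / (2 n)`. Bounds of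
the form `exp (-δ) z ≤ a ≤ exp (2 δ / 3) z` make the errors of all calls additive.
-/

namespace RecCount

open Function Set

section Involution

variable {V : Type*} [Finite V] {f g : V → V} {S : Set V}

omit [Finite V] in
lemma ncard_fixedPoints_restrict (hS : MapsTo f S S) :
    (fixedPoints (hS.restrict f S S)).ncard = (fixedPoints f ∩ S).ncard := by
  rw [← ncard_image_of_injective _ Subtype.val_injective]
  congr 1
  ext x
  simp [IsFixedPt, Subtype.ext_iff, and_comm]

lemma even_card_add_ncard_fixedPoints (hf : Involutive f) :
    Even (Nat.card V + (fixedPoints f).ncard) := by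
  classical
  have := Fintype.ofFinite V
  have hmod : Fintype.card V ≡ Fintype.card (fixedPoints f) [MOD 2] :=
    Equiv.Perm.card_fixedPoints_modEq (p := 2) (n := 1) (f := f)
      ((pow_two (M := Function.End V) f).trans (funext hf))
  rw [← Nat.card_coe_set_eq, Nat.card_eq_fintype_card, Nat.card_eq_fintype_card, Nat.even_iff,
    Nat.add_mod, hmod, ← Nat.add_mod, ← two_mul, Nat.mul_mod_right]

lemma even_ncard_add_ncard_fixedPoints (hf : Involutive f) (hS : MapsTo f S S) :
    Even (S.ncard + (fixedPoints f ∩ S).ncard) := by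
  rw [← ncard_fixedPoints_restrict hS, ← Nat.card_coe_set_eq]
  exact even_card_add_ncard_fixedPoints fun x => Subtype.ext (hf x)

lemma even_ncard_fixedPoints_add (hf : Involutive f) (hg : Involutive g) (hfS : MapsTo f S S)
    (hgS : MapsTo g S S) : Even ((fixedPoints f ∩ S).ncard + (fixedPoints g ∩ S).ncard) := by
  have hf' := even_ncard_add_ncard_fixedPoints hf hfS
  have hg' := even_ncard_add_ncard_fixedPoints hg hgS
  grind

lemma ncard_fixedPoints_piecewise (f g : V → V) (S : Set V) [∀ x, Decidable (x ∈ S)] :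
    (fixedPoints (S.piecewise f g)).ncard + (fixedPoints g ∩ S).ncard =
      (fixedPoints f ∩ S).ncard + (fixedPoints g).ncard := by
  have hfix : fixedPoints (S.piecewise f g) = (fixedPoints f ∩ S) ∪ (fixedPoints g \ S) := by
    ext x
    by_cases hx : x ∈ S <;> simp [IsFixedPt, hx]
  rw [hfix, ncard_union_eq (disjoint_sdiff_right.mono_left inter_subset_right), add_assoc,
    add_comm (ncard _) (ncard (_ ∩ S)), ncard_inter_add_ncard_sdiff_eq_ncard]

/-- The union of the matchings encoded by the involutions `f` and `g`: its components are
alternating paths and cycles. -/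
def alternatingGraph (f g : V → V) : SimpleGraph V :=
  SimpleGraph.fromRel fun x y => f x = y ∨ g x = y

omit [Finite V] in
lemma eq_or_eq_of_alternatingGraph_adj (hf : Involutive f) (hg : Involutive g) {x y : V}
    (h : (alternatingGraph f g).Adj x y) : f x = y ∨ g x = y := by
  rw [alternatingGraph, SimpleGraph.fromRel_adj] at h
  rcases h.2 with h | rfl | rfl
  exacts [h, Or.inl (hf y), Or.inr (hg y)]

/-- A connected graph on `N` vertices has at least `N - 1` edges, so its degrees fall short of `2`
by at most `2` in total. -/
lemma ncard_fixedPoints_add_le_two {H : SimpleGraph V} (hH : H.Connected)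
    (hadj : ∀ x y, H.Adj x y → f x = y ∨ g x = y) :
    (fixedPoints f).ncard + (fixedPoints g).ncard ≤ 2 := by
  classical
  have := Fintype.ofFinite V
  have hdeg (x : V) : H.degree x + ((if f x = x then 1 else 0) + if g x = x then 1 else 0) ≤ 2 := by
    have hsub : H.neighborFinset x ⊆ ({f x} : Finset V).erase x ∪ ({g x} : Finset V).erase x :=
      fun y hy => by
        have hxy := (H.mem_neighborFinset x y).1 hy
        grind [hxy.ne]
    have hle := (Finset.card_le_card hsub).trans (Finset.card_union_le _ _)
    rw [H.card_neighborFinset_eq_degree] at hle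
    grind [Finset.erase_eq_of_notMem]
  have hsum := Finset.sum_le_sum fun x (_ : x ∈ Finset.univ) => hdeg x
  have hcard := hH.card_vert_le_card_edgeSet_add_one
  have hfix (k : V → V) : (fixedPoints k).ncard = ∑ x, if k x = x then 1 else 0 := by
    rw [ncard_eq_toFinset_card', ← Finset.card_filter]
    congr 1
    ext x
    simp [IsFixedPt]
  rw [Finset.sum_add_distrib, Finset.sum_add_distrib, H.sum_degrees_eq_twice_card_edges, ← hfix,
    ← hfix] at hsum
  simp only [Nat.card_eq_fintype_card, Finset.sum_const, Finset.card_univ, smul_eq_mul,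
    SimpleGraph.edgeFinset_card] at hsum hcard
  omega

lemma exists_alternating_path (hf : Involutive f) (hg : Involutive g) {v : V} (hv : f v = v) :
    ∃ S : Set V, v ∈ S ∧ MapsTo f S S ∧ MapsTo g S S ∧
      (fixedPoints f ∩ S).ncard + (fixedPoints g ∩ S).ncard = 2 := by
  let C := (alternatingGraph f g).connectedComponentMk v
  have hmaps {k : V → V} (hk : ∀ x, k x ≠ x → (alternatingGraph f g).Adj x (k x)) :
      MapsTo k C.supp C.supp := fun x hx => by
    by_cases hkx : k x = x
    · rwa [hkx]
    · exact C.mem_supp_of_adj_mem_supp hx (hk x hkx)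
  have hfC : MapsTo f C.supp C.supp :=
    hmaps fun x hx => (SimpleGraph.fromRel_adj _ _ _).2 ⟨hx.symm, by simp⟩
  have hgC : MapsTo g C.supp C.supp :=
    hmaps fun x hx => (SimpleGraph.fromRel_adj _ _ _).2 ⟨hx.symm, by simp⟩
  have hle : (fixedPoints f ∩ C.supp).ncard + (fixedPoints g ∩ C.supp).ncard ≤ 2 := by
    rw [← ncard_fixedPoints_restrict hfC, ← ncard_fixedPoints_restrict hgC]
    refine ncard_fixedPoints_add_le_two C.connected_toSimpleGraph fun x y hxy => ?_
    simpa [Subtype.ext_iff] using eq_or_eq_of_alternatingGraph_adj hf hg hxy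
  have hpos : 0 < (fixedPoints f ∩ C.supp).ncard := (ncard_pos).2 ⟨v, hv, rfl⟩
  have heven := even_ncard_fixedPoints_add hf hg hfC hgC
  exact ⟨C.supp, rfl, hfC, hgC, by grind⟩

end Involution

section MatchingMap

variable {V : Type u} {G : SimpleGraph V} {f g : V → V} {S : Set V}

/-- A matching of `G`, encoded as the involution that exchanges the ends of its edges and fixes
the unmatched vertices. -/
def IsMatchingMap (G : SimpleGraph V) (f : V → V) : Prop :=
  Involutive f ∧ ∀ v, f v = v ∨ G.Adj v (f v)

lemma isMatchingMap_id (G : SimpleGraph V) : IsMatchingMap G id :=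
  ⟨fun _ => rfl, fun _ => Or.inl rfl⟩

lemma IsMatchingMap.mono {H : SimpleGraph V} (hle : H ≤ G) (hf : IsMatchingMap H f) :
    IsMatchingMap G f :=
  ⟨hf.1, fun v => (hf.2 v).imp_right (hle · )⟩

lemma isMatchingMap_swap [DecidableEq V] {x y : V} (hxy : G.Adj x y) :
    IsMatchingMap G (Equiv.swap x y) := by
  refine ⟨fun v => Equiv.swap_apply_self x y v, fun v => ?_⟩
  rcases eq_or_ne v x with rfl | hx
  · simp [hxy]
  rcases eq_or_ne v y with rfl | hy
  · simp [hxy.symm]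
  · simp [Equiv.swap_apply_of_ne_of_ne hx hy]

lemma mapsTo_compl_of_involutive (hf : Involutive f) (hS : MapsTo f S S) : MapsTo f Sᶜ Sᶜ :=
  fun x hx hfx => hx (hf x ▸ hS hfx)

lemma IsMatchingMap.piecewise [∀ x, Decidable (x ∈ S)] (hf : IsMatchingMap G f)
    (hg : IsMatchingMap G g) (hfS : MapsTo f S S) (hgS : MapsTo g S S) :
    IsMatchingMap G (S.piecewise f g) := by
  have hgS' {x} (hx : x ∉ S) : g x ∉ S := mapsTo_compl_of_involutive hg.1 hgS hx
  refine ⟨fun x => ?_, fun x => ?_⟩ <;> by_cases hx : x ∈ S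
  · simp [hx, hfS hx, hf.1 x]
  · simp [hx, hgS' hx, hg.1 x]
  · simpa [hx] using hf.2 x
  · simpa [hx] using hg.2 x

lemma IsMatchingMap.exists_add_edge [Finite V] (hf : IsMatchingMap G f) {x y : V}
    (hxy : G.Adj x y) (hx : f x = x) (hy : f y = y) :
    ∃ f', IsMatchingMap G f' ∧ (fixedPoints f').ncard + 2 = (fixedPoints f).ncard ∧
      ∀ v, v ≠ x → v ≠ y → f' v = f v := by
  classical
  have hswap : MapsTo (Equiv.swap x y) {x, y} {x, y} := by rintro v (rfl | rfl) <;> simp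
  have hfxy : MapsTo f {x, y} {x, y} := by rintro v (rfl | rfl) <;> simp [hx, hy]
  have hcard := ncard_fixedPoints_piecewise (Equiv.swap x y) f {x, y}
  have hmoved : fixedPoints (Equiv.swap x y) ∩ {x, y} = ∅ := by
    ext v
    have := hxy.ne
    simp only [mem_inter_iff, mem_fixedPoints, IsFixedPt, mem_insert_iff, mem_singleton_iff,
      mem_empty_iff_false]
    grind [Equiv.swap_apply_left, Equiv.swap_apply_right]
  have hfixed : fixedPoints f ∩ {x, y} = {x, y} :=
    inter_eq_right.2 (by rintro v (rfl | rfl) <;> assumption)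
  rw [hmoved, hfixed, ncard_pair hxy.ne, ncard_empty, zero_add] at hcard
  exact ⟨_, (isMatchingMap_swap hxy).piecewise hf hswap hfxy, hcard,
    fun v hvx hvy => piecewise_eq_of_notMem _ _ _ (by simp [hvx, hvy])⟩

open Classical in
/-- The involution that exchanges the ends of the edges of the matching `M`. -/
noncomputable def mate (M : G.Subgraph) (v : V) : V :=
  if h : ∃ w, M.Adj v w then h.choose else v

lemma mate_eq_iff {M : G.Subgraph} (hM : M.IsMatching) {v w : V} (hvw : v ≠ w) :
    mate M v = w ↔ M.Adj v w := by
  by_cases h : ∃ w, M.Adj v w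
  · rw [mate, dif_pos h]
    exact ⟨fun hw => hw ▸ h.choose_spec, hM.eq_of_adj_left h.choose_spec⟩
  · rw [mate, dif_neg h]
    exact iff_of_false hvw (h ⟨w, ·⟩)

lemma mate_eq_self_iff {M : G.Subgraph} (hM : M.IsMatching) {v : V} :
    mate M v = v ↔ v ∉ M.verts := by
  by_cases h : ∃ w, M.Adj v w
  · obtain ⟨w, hw⟩ := h
    rw [(mate_eq_iff hM hw.ne).2 hw]
    exact iff_of_false hw.ne.symm (not_not.2 hw.fst_mem)
  · rw [mate, dif_neg h]
    exact iff_of_true rfl fun hv => h (hM hv).exists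

lemma isMatchingMap_mate {M : G.Subgraph} (hM : M.IsMatching) : IsMatchingMap G (mate M) := by
  have hadj {v : V} (hv : mate M v ≠ v) : M.Adj v (mate M v) := (mate_eq_iff hM hv.symm).1 rfl
  refine ⟨fun v => ?_, fun v => or_iff_not_imp_left.2 fun hv => (hadj hv).adj_sub⟩
  by_cases hv : mate M v = v
  · rw [hv, hv]
  · exact (mate_eq_iff hM hv).2 (hadj hv).symm

/-- The matching encoded by `f`, as a subgraph. -/
def IsMatchingMap.toSubgraph (hf : IsMatchingMap G f) : G.Subgraph where
  verts := {v | f v ≠ v}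
  Adj v w := v ≠ w ∧ f v = w
  adj_sub {v _} h := h.2 ▸ (hf.2 v).resolve_left fun hv => h.1 (hv.symm.trans h.2)
  edge_vert h hv := h.1 (hv.symm.trans h.2)
  symm := ⟨fun v _ h => ⟨h.1.symm, h.2 ▸ hf.1 v⟩⟩

lemma IsMatchingMap.isMatching_toSubgraph (hf : IsMatchingMap G f) : hf.toSubgraph.IsMatching :=
  fun v hv => ⟨f v, ⟨hv.symm, rfl⟩, fun _ h => h.2.symm⟩

lemma IsMatchingMap.mate_toSubgraph (hf : IsMatchingMap G f) : mate hf.toSubgraph = f := by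
  funext v
  by_cases hv : f v = v
  · rw [hv, mate_eq_self_iff hf.isMatching_toSubgraph]
    exact not_not.2 hv
  · exact (mate_eq_iff hf.isMatching_toSubgraph (Ne.symm hv)).2 ⟨Ne.symm hv, rfl⟩

lemma mate_injOn : InjOn mate {M : G.Subgraph | M.IsMatching} := by
  intro M hM N hN hMN
  refine SimpleGraph.Subgraph.ext ?_ ?_
  · ext v
    rw [← not_iff_not, ← mate_eq_self_iff hM, ← mate_eq_self_iff hN, hMN]
  · ext v w
    rcases eq_or_ne v w with rfl | hvw
    · exact iff_of_false (fun h => h.ne rfl) fun h => h.ne rfl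
    · rw [← mate_eq_iff hM hvw, ← mate_eq_iff hN hvw, hMN]

lemma two_mul_ncard_edgeSet [Finite V] {M : G.Subgraph} (hM : M.IsMatching) :
    2 * M.edgeSet.ncard = M.verts.ncard := by
  classical
  have := Fintype.ofFinite V
  have hdeg (v : V) : M.spanningCoe.degree v = if v ∈ M.verts then 1 else 0 := by
    split_ifs with hv
    · rw [SimpleGraph.degree_eq_one_iff_existsUnique_adj]
      exact hM hv
    · rw [SimpleGraph.degree_eq_zero]
      exact fun w hw => hv (M.edge_vert hw)
  have hsum := M.spanningCoe.sum_degrees_eq_twice_card_edges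
  rw [Finset.sum_congr rfl fun v _ => hdeg v, Finset.sum_boole] at hsum
  rw [← M.edgeSet_spanningCoe, ← SimpleGraph.coe_edgeFinset, ncard_coe_finset, ← hsum,
    ncard_eq_toFinset_card', toFinset, Nat.cast_id]
  simp

lemma two_mul_ncard_edgeSet_add_ncard_fixedPoints [Finite V] {M : G.Subgraph}
    (hM : M.IsMatching) : 2 * M.edgeSet.ncard + (fixedPoints (mate M)).ncard = Nat.card V := by
  have hfix : fixedPoints (mate M) = M.vertsᶜ := Set.ext fun v => mate_eq_self_iff hM
  rw [two_mul_ncard_edgeSet hM, hfix, ncard_add_ncard_compl]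

/-- The matching encoded by `f` is a maximum matching. -/
def IsMaxMatchingMap (G : SimpleGraph V) (f : V → V) : Prop :=
  IsMatchingMap G f ∧
    ∀ g, IsMatchingMap G g → (fixedPoints f).ncard ≤ (fixedPoints g).ncard

lemma IsMaxMatchingMap.of_ncard_le (hf : IsMaxMatchingMap G f) (hg : IsMatchingMap G g)
    (h : (fixedPoints g).ncard ≤ (fixedPoints f).ncard) : IsMaxMatchingMap G g :=
  ⟨hg, fun k hk => h.trans (hf.2 k hk)⟩

lemma IsMaxMatchingMap.ncard_eq (hf : IsMaxMatchingMap G f) (hg : IsMaxMatchingMap G g) :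
    (fixedPoints g).ncard = (fixedPoints f).ncard :=
  le_antisymm (hg.2 f hf.1) (hf.2 g hg.1)

lemma isMaximumMatching_iff [Finite V] {M : G.Subgraph} (hM : M.IsMatching) :
    IsMaximumMatching M ↔ IsMaxMatchingMap G (mate M) := by
  have hcard := two_mul_ncard_edgeSet_add_ncard_fixedPoints hM
  refine ⟨fun h => ⟨isMatchingMap_mate hM, fun g hg => ?_⟩, fun h => ⟨hM, fun N hN => ?_⟩⟩
  · have hcard' := two_mul_ncard_edgeSet_add_ncard_fixedPoints hg.isMatching_toSubgraph
    have hle := h.2 _ hg.isMatching_toSubgraph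
    rw [hg.mate_toSubgraph] at hcard'
    omega
  · have hcard' := two_mul_ncard_edgeSet_add_ncard_fixedPoints hN
    have hle := h.2 _ (isMatchingMap_mate hN)
    omega

lemma mem_geD_iff [Finite V] {v : V} : v ∈ geD G ↔ ∃ f, IsMaxMatchingMap G f ∧ f v = v := by
  constructor
  · rintro ⟨M, hM, hv⟩
    exact ⟨mate M, (isMaximumMatching_iff hM.1).1 hM, (mate_eq_self_iff hM.1).2 hv⟩
  · rintro ⟨f, hf, hv⟩
    refine ⟨hf.1.toSubgraph, ?_, not_not.2 hv⟩
    rwa [isMaximumMatching_iff hf.1.isMatching_toSubgraph, hf.1.mate_toSubgraph]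

end MatchingMap

section Isolate

variable {V : Type u} {G : SimpleGraph V} {f : V → V}

/-- The graph `G` with all edges at vertices of `B` removed. Isolating `B` instead of deleting it
keeps the vertex type fixed. -/
def isolate (G : SimpleGraph V) (B : Set V) : SimpleGraph V where
  Adj x y := G.Adj x y ∧ x ∉ B ∧ y ∉ B
  symm := ⟨fun _ _ h => ⟨h.1.symm, h.2.2, h.2.1⟩⟩
  loopless := ⟨fun x h => G.loopless.irrefl x h.1⟩

lemma isolate_le (G : SimpleGraph V) (B : Set V) : isolate G B ≤ G := fun _ _ h => h.1

lemma isolate_empty (G : SimpleGraph V) : isolate G ∅ = G := by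
  ext; simp [isolate]

lemma isolate_insert (G : SimpleGraph V) (a : V) (B : Set V) :
    isolate G (insert a B) = isolate (isolate G B) {a} := by
  ext; simp only [isolate, mem_insert_iff, mem_singleton_iff]; tauto

lemma IsMatchingMap.apply_of_mem_isolate {B : Set V} (hf : IsMatchingMap (isolate G B) f) {v : V}
    (hv : v ∈ B) : f v = v :=
  (hf.2 v).resolve_right fun h => h.2.1 hv

open Classical in
/-- The matching `f` without its edges at vertices of `B`. -/
noncomputable def strip (f : V → V) (B : Set V) (v : V) : V :=
  if v ∈ B ∨ f v ∈ B then v else f v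

lemma strip_empty (f : V → V) : strip f ∅ = f := by
  ext; simp [strip]

lemma strip_insert (f : V → V) (a : V) (B : Set V) :
    strip f (insert a B) = strip (strip f B) {a} := by
  ext
  simp only [strip, mem_insert_iff, mem_singleton_iff]
  grind

lemma strip_eq_self_iff {B : Set V} {v : V} : strip f B v = v ↔ f v = v ∨ v ∈ B ∨ f v ∈ B := by
  simp only [strip]
  grind

lemma IsMatchingMap.strip (hf : IsMatchingMap G f) (B : Set V) :
    IsMatchingMap (isolate G B) (strip f B) := by
  refine ⟨fun v => ?_, fun v => ?_⟩ <;> simp only [RecCount.strip]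
  · grind [hf.1 v]
  · split_ifs with hv
    · exact Or.inl rfl
    · exact (hf.2 v).imp_right fun hadj => ⟨hadj, not_or.1 hv⟩

end Isolate

section GallaiEdmonds

variable {V : Type u} [Finite V] {G : SimpleGraph V} {f g : V → V}

lemma IsMaxMatchingMap.not_adj (hf : IsMaxMatchingMap G f) {x y : V} (hx : f x = x)
    (hy : f y = y) : ¬ G.Adj x y := fun hxy => by
  obtain ⟨f', hf', hcard, -⟩ := hf.1.exists_add_edge hxy hx hy
  have hle := hf.2 f' hf'
  omega

lemma IsMaxMatchingMap.exists_exchange (hf : IsMaxMatchingMap G f) (hg : IsMaxMatchingMap G g)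
    {x y z : V} (hxy : x ≠ y) (hx : g x = x) (hy : g y = y) (hz : f z = z) :
    ∃ h, IsMaxMatchingMap G h ∧ h z = z ∧ (h x = x ∨ h y = y) := by
  classical
  obtain ⟨S, hzS, hfS, hgS, htwo⟩ := exists_alternating_path hf.1.1 hg.1.1 hz
  have hpos : 0 < (fixedPoints f ∩ S).ncard := (ncard_pos).2 ⟨z, hz, hzS⟩
  have hcardf := ncard_fixedPoints_piecewise g f S
  have hcardg := ncard_fixedPoints_piecewise f g S
  have hlef := hf.2 _ (hg.1.piecewise hf.1 hgS hfS)
  have hone : (fixedPoints g ∩ S).ncard ≤ 1 := by omega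
  refine ⟨S.piecewise f g, hg.of_ncard_le (hf.1.piecewise hg.1 hfS hgS) (by omega),
    by simp [hzS, hz], ?_⟩
  by_cases hxS : x ∈ S
  · have hyS : y ∉ S := fun hyS => hxy ((ncard_le_one_iff).1 hone ⟨hx, hxS⟩ ⟨hy, hyS⟩)
    exact Or.inr (by simp [hyS, hy])
  · exact Or.inl (by simp [hxS, hx])

/-- **Gallai's lemma**: a maximum matching misses at most one vertex of each connected part of
`D(G)`. -/
lemma IsMaxMatchingMap.eq_of_reachable {W : Type*} {H : SimpleGraph W} (φ : H →g G)
    (hφ : ∀ w, φ w ∈ geD G) {x y : W} (hxy : H.Reachable x y) (hf : IsMaxMatchingMap G f)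
    (hx : f (φ x) = φ x) (hy : f (φ y) = φ y) : φ x = φ y := by
  rw [SimpleGraph.reachable_iff_reflTransGen] at hxy
  induction hxy generalizing f with
  | refl => rfl
  | @tail z y _ hzy ih =>
    have hzy' : G.Adj (φ z) (φ y) := φ.map_adj hzy
    by_contra hne
    obtain ⟨g, hg, hgz⟩ := mem_geD_iff.1 (hφ z)
    obtain ⟨h, hh, hhz, hhx | hhy⟩ := hg.exists_exchange hf hne hx hy hgz
    · exact hf.not_adj hx hy (ih hh hhx hhz ▸ hzy')
    · exact hh.not_adj hhz hhy hzy'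

section Stability

variable {a : V}

lemma IsMaxMatchingMap.ncard_fixedPoints_strip (hf : IsMaxMatchingMap G f) (ha : a ∉ geD G) :
    (fixedPoints (RecCount.strip f {a})).ncard = (fixedPoints f).ncard + 2 := by
  have hfa : f a ≠ a := fun h => ha (mem_geD_iff.2 ⟨f, hf, h⟩)
  have hfix : fixedPoints (RecCount.strip f {a}) = fixedPoints f ∪ {a, f a} := by
    ext v
    simp only [mem_fixedPoints, IsFixedPt, strip_eq_self_iff, mem_singleton_iff, mem_union,
      mem_insert_iff]
    grind [hf.1.1 v, hf.1.1 a]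
  rw [hfix, ncard_union_eq, ncard_pair hfa.symm]
  rw [Set.disjoint_right]
  rintro v (rfl | rfl) h
  exacts [hfa h, hfa (hf.1.1.injective h)]

lemma IsMaxMatchingMap.strip_singleton (hf : IsMaxMatchingMap G f) (ha : a ∉ geD G) :
    IsMaxMatchingMap (isolate G {a}) (strip f {a}) := by
  refine ⟨hf.1.strip _, fun g hg => ?_⟩
  have hg' := hg.mono (isolate_le G _)
  have hlt : (fixedPoints f).ncard < (fixedPoints g).ncard := by
    by_contra! hle
    exact ha (mem_geD_iff.2 ⟨g, hf.of_ncard_le hg' hle, hg.apply_of_mem_isolate rfl⟩)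
  have heven := even_ncard_fixedPoints_add hf.1.1 hg.1 (mapsTo_univ f univ) (mapsTo_univ g univ)
  rw [inter_univ, inter_univ] at heven
  rw [hf.ncard_fixedPoints_strip ha]
  grind

lemma mem_geD_of_mem_geD_isolate (ha : a ∉ geD G) {d v : V} (hd : d ∈ geD G) (had : G.Adj a d)
    (hv : v ∈ geD (isolate G {a})) (hva : v ≠ a) : v ∈ geD G := by
  classical
  obtain ⟨g, hg, hgd⟩ := mem_geD_iff.1 hd
  obtain ⟨f, hf, hfv⟩ := mem_geD_iff.1 hv
  have hfa : f a = a := hf.1.apply_of_mem_isolate rfl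
  have hfG := hf.1.mono (isolate_le G _)
  have hcard : (fixedPoints f).ncard = (fixedPoints g).ncard + 2 := by
    rw [← hg.ncard_fixedPoints_strip ha, (hg.strip_singleton ha).ncard_eq hf]
  obtain ⟨S, hvS, hfS, hgS, htwo⟩ := exists_alternating_path hfG.1 hg.1.1 hfv
  have hpos : 0 < (fixedPoints f ∩ S).ncard := (ncard_pos).2 ⟨v, hfv, hvS⟩
  have hcardf := ncard_fixedPoints_piecewise f g S
  have hcardg := ncard_fixedPoints_piecewise g f S
  have hfg := hfG.piecewise hg.1 hfS hgS
  have hgf := hg.1.piecewise hfG hgS hfS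
  obtain hone | hzero : (fixedPoints g ∩ S).ncard = 1 ∨ (fixedPoints g ∩ S).ncard = 0 := by omega
  · exact mem_geD_iff.2 ⟨_, hg.of_ncard_le hfg (by omega), by simp [hvS, hfv]⟩
  by_cases haS : a ∈ S
  · have hdS : d ∉ S := fun hdS => by
      rw [ncard_eq_zero] at hzero
      exact hzero.le ⟨hgd, hdS⟩
    obtain ⟨h, hh, hcardh, hfix⟩ := hfg.exists_add_edge had (by simp [haS, hfa])
      (by simp [hdS, hgd])
    refine mem_geD_iff.2 ⟨h, hg.of_ncard_le hh (by omega), ?_⟩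
    rw [hfix v hva (by rintro rfl; exact hdS hvS)]
    simp [hvS, hfv]
  · exact absurd (mem_geD_iff.2 ⟨_, hg.of_ncard_le hgf (by omega), by simp [haS, hfa]⟩) ha

/-- The **stability lemma**, usually stated as `D(G - a) = D(G)`: isolating `a` instead of deleting
it adds `a` to `D(G)`. -/
lemma geD_isolate_singleton (ha : a ∈ geA G) : geD (isolate G {a}) = insert a (geD G) := by
  obtain ⟨haD, d, hd, had⟩ := ha
  ext v
  refine ⟨fun hv => or_iff_not_imp_left.2 (mem_geD_of_mem_geD_isolate haD hd had hv), ?_⟩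
  rintro (rfl | hv)
  · obtain ⟨g, hg, -⟩ := mem_geD_iff.1 hd
    exact mem_geD_iff.2 ⟨_, hg.strip_singleton haD, strip_eq_self_iff.2 (by simp)⟩
  · obtain ⟨f, hf, hfv⟩ := mem_geD_iff.1 hv
    exact mem_geD_iff.2 ⟨_, hf.strip_singleton haD, strip_eq_self_iff.2 (by simp [hfv])⟩

end Stability

lemma geD_isolate_and_isMaxMatchingMap_strip {B : Set V} (hB : B ⊆ geA G) :
    geD (isolate G B) = geD G ∪ B ∧
      ∀ f, IsMaxMatchingMap G f → IsMaxMatchingMap (isolate G B) (strip f B) := by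
  induction B, B.toFinite using Set.Finite.induction_on with
  | empty => simp [isolate_empty, strip_empty]
  | @insert a B haB _ ih =>
    obtain ⟨hD, hmax⟩ := ih ((subset_insert _ _).trans hB)
    obtain ⟨haD, d, hd, had⟩ := hB (mem_insert a B)
    have hdB : d ∉ B := fun h => (hB (mem_insert_of_mem _ h)).1 hd
    have ha : a ∈ geA (isolate G B) :=
      ⟨by simp [hD, haD, haB], d, hD ▸ Or.inl hd, had, haB, hdB⟩
    rw [isolate_insert, geD_isolate_singleton ha, hD, union_insert]
    exact ⟨rfl, fun f hf => strip_insert f a B ▸ (hmax f hf).strip_singleton ha.1⟩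

lemma geD_subset_geD_isolate_geA : geD G ⊆ geD (isolate G (geA G)) :=
  subset_union_left.trans (geD_isolate_and_isMaxMatchingMap_strip Subset.rfl).1.ge

lemma IsMaxMatchingMap.strip_geA (hf : IsMaxMatchingMap G f) :
    IsMaxMatchingMap (isolate G (geA G)) (strip f (geA G)) :=
  (geD_isolate_and_isMaxMatchingMap_strip Subset.rfl).2 f hf

lemma IsMaxMatchingMap.apply_mem_geD (hf : IsMaxMatchingMap G f) {a : V} (ha : a ∈ geA G) :
    f a ∈ geD G := by
  have hmem : f a ∈ geD (isolate G {a}) :=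
    mem_geD_iff.2 ⟨_, hf.strip_singleton ha.1, strip_eq_self_iff.2 (by simp [hf.1.1 a])⟩
  rw [geD_isolate_singleton ha] at hmem
  exact hmem.resolve_left fun hfa => ha.1 (mem_geD_iff.2 ⟨f, hf, hfa⟩)

variable (K : (G.induce (geD G)).ConnectedComponent)

omit [Finite V] in
lemma IsMatchingMap.mapsTo_supp (hg : IsMatchingMap (isolate G (geA G)) g) :
    MapsTo g (Subtype.val '' K.supp) (Subtype.val '' K.supp) := by
  rintro _ ⟨x, hx, rfl⟩
  rcases hg.2 x with h | h
  · rw [h]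
    exact mem_image_of_mem _ hx
  · have hgx : g x ∈ geD G := by
      by_contra hgx
      exact h.2.2 ⟨hgx, x, x.2, h.1.symm⟩
    exact ⟨⟨g x, hgx⟩, K.mem_supp_of_adj_mem_supp hx h.1, rfl⟩

lemma IsMaxMatchingMap.ncard_fixedPoints_inter_supp_le_one
    (hg : IsMaxMatchingMap (isolate G (geA G)) g) :
    (fixedPoints g ∩ Subtype.val '' K.supp).ncard ≤ 1 := by
  let φ : G.induce (geD G) →g isolate G (geA G) :=
    ⟨Subtype.val, fun {y z} h => ⟨h, fun hy => hy.1 y.2, fun hz => hz.1 z.2⟩⟩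
  rw [ncard_le_one_iff]
  rintro _ _ ⟨hx, x, hxK, rfl⟩ ⟨hy, y, hyK, rfl⟩
  exact hg.eq_of_reachable φ (fun w => geD_subset_geD_isolate_geA w.2)
    (K.reachable_of_mem_supp hxK hyK) hx hy

lemma odd_ncard_supp : Odd (Subtype.val '' K.supp).ncard := by
  obtain ⟨z, hz⟩ := K.nonempty_supp
  obtain ⟨g, hg, hgz⟩ : ∃ g, IsMaxMatchingMap (isolate G (geA G)) g ∧ g z = z :=
    mem_geD_iff.1 (geD_subset_geD_isolate_geA z.2)
  have heven := even_ncard_add_ncard_fixedPoints hg.1.1 (hg.1.mapsTo_supp K)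
  have hle := hg.ncard_fixedPoints_inter_supp_le_one K
  have hpos : 0 < (fixedPoints g ∩ Subtype.val '' K.supp).ncard :=
    (ncard_pos).2 ⟨z, hgz, z, hz, rfl⟩
  grind

lemma IsMaxMatchingMap.existsUnique_exposed (hf : IsMaxMatchingMap G f) :
    ∃! x : geD G, x ∈ K.supp ∧ (f x = x ∨ f x ∈ geA G) := by
  have hstrip := hf.strip_geA
  have heven := even_ncard_add_ncard_fixedPoints hstrip.1.1 (hstrip.1.mapsTo_supp K)
  have hle := hstrip.ncard_fixedPoints_inter_supp_le_one K
  have hpos : 0 < (fixedPoints (strip f (geA G)) ∩ Subtype.val '' K.supp).ncard := by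
    have := odd_ncard_supp K
    grind
  have hiff (y : geD G) : strip f (geA G) y = y ↔ f y = y ∨ f y ∈ geA G := by
    simp [strip_eq_self_iff, show (y : V) ∉ geA G from fun h => h.1 y.2]
  obtain ⟨_, hx, x, hxK, rfl⟩ := (ncard_pos).1 hpos
  refine ⟨x, ⟨hxK, (hiff x).1 hx⟩, fun y ⟨hyK, hy⟩ => Subtype.ext ?_⟩
  exact (ncard_le_one_iff).1 hle ⟨(hiff y).2 hy, y, hyK, rfl⟩ ⟨hx, x, hxK, rfl⟩

end GallaiEdmonds

section PerfectMaps

variable {V W : Type u} {G : SimpleGraph V} {H : SimpleGraph W} {f g : V → V} {s t : Set V}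

/-- The perfect matchings of the subgraph of `G` induced on `s`, encoded as involutions of the whole
vertex set that fix the vertices outside `s`. -/
def perfectMaps (G : SimpleGraph V) (s : Set V) : Set (V → V) :=
  {f | IsMatchingMap G f ∧ fixedPoints f = sᶜ}

lemma apply_eq_self_of_mem_perfectMaps (hf : f ∈ perfectMaps G s) {v : V} (hv : v ∉ s) :
    f v = v :=
  hf.2.ge hv

lemma mapsTo_of_mem_perfectMaps (hf : f ∈ perfectMaps G s) : MapsTo f s s := fun v hv => by
  by_contra hfv
  have hfix : f (f v) = f v := apply_eq_self_of_mem_perfectMaps hf hfv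
  exact hfv (by rwa [hf.1.1.injective hfix])

lemma eq_of_mem_perfectMaps_of_eqOn (hf : f ∈ perfectMaps G s) (hg : g ∈ perfectMaps G s)
    (h : EqOn f g s) : f = g := by
  funext v
  by_cases hv : v ∈ s
  · exact h hv
  · rw [apply_eq_self_of_mem_perfectMaps hf hv, apply_eq_self_of_mem_perfectMaps hg hv]

lemma perfectMaps_empty (G : SimpleGraph V) : perfectMaps G ∅ = {id} := by
  refine eq_singleton_iff_unique_mem.2 ⟨⟨isMatchingMap_id G, by simp⟩, fun f hf => ?_⟩
  exact funext fun v => apply_eq_self_of_mem_perfectMaps hf (notMem_empty v)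

lemma numPM_eq_ncard_perfectMaps_univ (G : SimpleGraph V) :
    numPM G = (perfectMaps G univ).ncard := by
  have himage : perfectMaps G univ = mate '' {M : G.Subgraph | M.IsPerfectMatching} := by
    ext f
    constructor
    · rintro ⟨hf, hfix⟩
      refine ⟨hf.toSubgraph, ⟨hf.isMatching_toSubgraph, fun v hv => ?_⟩, hf.mate_toSubgraph⟩
      simpa using hfix.le hv
    · rintro ⟨M, ⟨hM, hspan⟩, rfl⟩
      refine ⟨isMatchingMap_mate hM, ?_⟩
      rw [compl_univ, eq_empty_iff_forall_notMem]
      exact fun v hv => (mate_eq_self_iff hM).1 hv (hspan v)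
  rw [himage, (mate_injOn.mono fun M hM => hM.1).ncard_image]
  exact Nat.card_coe_set_eq _

lemma extend_mem_perfectMaps (e : H ↪g G) {h : W → W} (hh : h ∈ perfectMaps H univ) :
    extend e (e ∘ h) id ∈ perfectMaps G (range e) := by
  have hin (w : W) : extend e (e ∘ h) id (e w) = e (h w) := e.injective.extend_apply _ _ w
  have hout {v : V} (hv : v ∉ range e) : extend e (e ∘ h) id v = v := extend_apply' _ _ v hv
  have hne (w : W) : h w ≠ w := fun hw => absurd (hh.2.le hw) (by simp)
  refine ⟨⟨fun v => ?_, fun v => ?_⟩, ?_⟩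
  · by_cases hv : v ∈ range e
    · obtain ⟨w, rfl⟩ := hv
      rw [hin, hin, hh.1.1 w]
    · rw [hout hv, hout hv]
  · by_cases hv : v ∈ range e
    · obtain ⟨w, rfl⟩ := hv
      rw [hin, e.map_adj_iff]
      exact Or.inr ((hh.1.2 w).resolve_left (hne w))
    · exact Or.inl (hout hv)
  · ext v
    refine ⟨?_, hout⟩
    rintro hv ⟨w, rfl⟩
    exact hne w (e.injective ((hin w).symm.trans hv))

lemma exists_extend_eq_of_mem_perfectMaps (e : H ↪g G) (hf : f ∈ perfectMaps G (range e)) :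
    ∃ h ∈ perfectMaps H univ, extend e (e ∘ h) id = f := by
  choose h hh using fun w => mapsTo_of_mem_perfectMaps hf (mem_range_self w)
  have hne (w : W) : f (e w) ≠ e w := fun hw => hf.2.le hw ⟨w, rfl⟩
  refine ⟨h, ⟨⟨fun w => e.injective ?_, fun w => ?_⟩, ?_⟩, ?_⟩
  · rw [hh, hh, hf.1.1]
  · rw [← e.map_adj_iff, hh]
    exact Or.inr ((hf.1.2 _).resolve_left (hne w))
  · rw [compl_univ, eq_empty_iff_forall_notMem]
    exact fun w hw => hne w (by rw [← hh, hw])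
  · funext v
    by_cases hv : v ∈ range e
    · obtain ⟨w, rfl⟩ := hv
      rw [e.injective.extend_apply, comp_apply, hh]
    · rw [extend_apply' _ _ _ hv, id, apply_eq_self_of_mem_perfectMaps hf hv]

lemma numPM_eq_ncard_perfectMaps_range (e : H ↪g G) :
    numPM H = (perfectMaps G (range e)).ncard := by
  have himage : perfectMaps G (range e) =
      (fun h => extend e (e ∘ h) id) '' perfectMaps H univ := by
    ext f
    constructor
    · exact exists_extend_eq_of_mem_perfectMaps e
    · rintro ⟨h, hh, rfl⟩
      exact extend_mem_perfectMaps e hh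
  rw [himage, ncard_image_of_injective, numPM_eq_ncard_perfectMaps_univ]
  exact (extend_injective e.injective id).comp e.injective.comp_left

lemma piecewise_mem_perfectMaps [∀ v, Decidable (v ∈ s)] (hst : Disjoint s t)
    (hf : f ∈ perfectMaps G s) (hg : g ∈ perfectMaps G t) :
    s.piecewise f g ∈ perfectMaps G (s ∪ t) := by
  have hgs : MapsTo g s s := fun v hv => by
    rwa [apply_eq_self_of_mem_perfectMaps hg (hst.notMem_of_mem_left hv)]
  refine ⟨hf.1.piecewise hg.1 (mapsTo_of_mem_perfectMaps hf) hgs, ?_⟩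
  ext v
  by_cases hv : v ∈ s
  · have hfv : f v ≠ v := fun h => hf.2.le h hv
    simp [IsFixedPt, hv, hfv]
  · have hgv : g v = v ↔ v ∉ t := Set.ext_iff.1 hg.2 v
    simp [IsFixedPt, hv, hgv]

lemma piecewise_id_mem_perfectMaps [∀ v, Decidable (v ∈ s)] (hst : s ⊆ t)
    (hf : f ∈ perfectMaps G t) (hs : MapsTo f s s) : s.piecewise f id ∈ perfectMaps G s := by
  refine ⟨hf.1.piecewise (isMatchingMap_id G) hs (mapsTo_id s), ?_⟩
  ext v
  by_cases hv : v ∈ s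
  · have hfv : f v ≠ v := fun h => hf.2.le h (hst hv)
    simp [IsFixedPt, hv, hfv]
  · simp [IsFixedPt, hv]

lemma ncard_perfectMaps_eqOn (hst : Disjoint s t) (hg : g ∈ perfectMaps G t) :
    {f ∈ perfectMaps G (s ∪ t) | EqOn f g t}.ncard = (perfectMaps G s).ncard := by
  classical
  have himage : {f ∈ perfectMaps G (s ∪ t) | EqOn f g t} =
      (fun f => s.piecewise f g) '' perfectMaps G s := by
    ext f
    constructor
    · rintro ⟨hf, hfg⟩
      have hft : MapsTo f t t := (mapsTo_of_mem_perfectMaps hg).congr hfg.symm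
      have hfs : MapsTo f s s := fun v hv =>
        (mapsTo_of_mem_perfectMaps hf (Or.inl hv)).resolve_right fun hfv =>
          hst.notMem_of_mem_left hv (hf.1.1 v ▸ hft hfv)
      have hmem := piecewise_id_mem_perfectMaps subset_union_left hf hfs
      refine ⟨s.piecewise f id, hmem, eq_of_mem_perfectMaps_of_eqOn
        (piecewise_mem_perfectMaps hst hmem hg) hf ?_⟩
      rintro v (hv | hv)
      · simp [hv]
      · simp [hst.notMem_of_mem_right hv, hfg hv]
    · rintro ⟨f, hf, rfl⟩
      exact ⟨piecewise_mem_perfectMaps hst hf hg,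
        fun v hv => piecewise_eq_of_notMem _ _ _ (hst.notMem_of_mem_right hv)⟩
  rw [himage]
  refine InjOn.ncard_image fun f hf f' hf' hff' => ?_
  refine eq_of_mem_perfectMaps_of_eqOn hf hf' fun v hv => ?_
  simpa [hv] using congrFun hff' v

variable [Finite V]

lemma ncard_perfectMaps_union (hst : Disjoint s t) (hadj : ∀ x ∈ s, ∀ y ∈ t, ¬ G.Adj x y) :
    (perfectMaps G (s ∪ t)).ncard = (perfectMaps G s).ncard * (perfectMaps G t).ncard := by
  classical
  have hmaps {f : V → V} (hf : f ∈ perfectMaps G (s ∪ t)) : MapsTo f t t := fun v hv => by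
    rcases hf.1.2 v with hfv | hfv
    · rwa [hfv]
    · exact (mapsTo_of_mem_perfectMaps hf (Or.inr hv)).resolve_left fun h => hadj _ h v hv hfv.symm
  have hunion : perfectMaps G (s ∪ t) =
      ⋃ g ∈ perfectMaps G t, {f ∈ perfectMaps G (s ∪ t) | EqOn f g t} := by
    ext f
    refine Iff.trans ⟨fun hf => ⟨t.piecewise f id, ?_, hf, ?_⟩, fun ⟨_, _, h⟩ => h.1⟩
      mem_iUnion₂.symm
    · exact piecewise_id_mem_perfectMaps subset_union_right hf (hmaps hf)
    · exact fun v hv => by simp [hv]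
  have hfiber : ∀ g ∈ perfectMaps G t,
      {f ∈ perfectMaps G (s ∪ t) | EqOn f g t}.ncard = (perfectMaps G s).ncard :=
    fun g hg => ncard_perfectMaps_eqOn hst hg
  rw [hunion, (toFinite _).ncard_biUnion (fun _ _ => toFinite _), finsum_mem_congr rfl hfiber,
    finsum_mem_eq_finite_toFinset_sum _ (toFinite _), Finset.sum_const, smul_eq_mul, mul_comm,
    ncard_eq_toFinset_card (perfectMaps G t)]
  intro g hg g' hg' hne
  refine Set.disjoint_left.2 fun f hf hf' => hne ?_
  exact eq_of_mem_perfectMaps_of_eqOn hg hg' (hf.2.symm.trans hf'.2)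

lemma ncard_perfectMaps_biUnion {ι : Type*} (I : Finset ι) {s : ι → Set V}
    (hs : (I : Set ι).PairwiseDisjoint s)
    (hadj : (I : Set ι).Pairwise fun i j => ∀ x ∈ s i, ∀ y ∈ s j, ¬ G.Adj x y) :
    (perfectMaps G (⋃ i ∈ I, s i)).ncard = ∏ i ∈ I, (perfectMaps G (s i)).ncard := by
  classical
  induction I using Finset.induction_on with
  | empty => simp [perfectMaps_empty]
  | insert i I hi ih =>
    rw [Finset.coe_insert] at hs hadj
    have hne {j : ι} (hj : j ∈ I) : i ≠ j := fun hij => hi (hij ▸ hj)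
    rw [Finset.set_biUnion_insert, ncard_perfectMaps_union, Finset.prod_insert hi,
      ih (hs.subset (subset_insert _ _)) (hadj.mono (subset_insert _ _))]
    · exact disjoint_iUnion₂_right.2 fun j hj =>
        hs (mem_insert i _) (mem_insert_of_mem i hj) (hne hj)
    · intro x hx y hy
      obtain ⟨j, hj, hyj⟩ := mem_iUnion₂.1 hy
      exact hadj (mem_insert i _) (mem_insert_of_mem i hj) (hne hj) x hx y hyj

end PerfectMaps

section Transversals

variable {X D Y : Type u}

/-- The transversals of `p`: the choices of a related element for each `x` such that every fibre of
`p` is chosen from exactly once. The perfect matchings of `G` induce transversals of the partition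
of `D(G - u)` into components. -/
def transversals (R : X → D → Prop) (p : D → Y) : Set (X → D) :=
  {τ | (∀ x, R x (τ x)) ∧ Bijective (p ∘ τ)}

variable [Finite X] [Finite D]

lemma finprod_finsum_mem (s : X → Set D) (m : X → D → ℝ) :
    ∏ᶠ x, ∑ᶠ d ∈ s x, m x d = ∑ᶠ τ ∈ univ.pi s, ∏ᶠ x, m x (τ x) := by
  classical
  cases nonempty_fintype X
  cases nonempty_fintype D
  have hpi : univ.pi s = Fintype.piFinset fun x => (s x).toFinset := by ext; simp
  simp_rw [hpi, finsum_mem_coe_finset, finprod_eq_prod_of_fintype,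
    finsum_mem_eq_toFinset_sum, Finset.prod_univ_sum]

lemma permanent_finsum (R : X → D → Prop) (p : D → Y) (m : D → ℝ) :
    permanent (fun x y => ∑ᶠ (d) (_ : p d = y ∧ R x d), m d) =
      ∑ᶠ τ ∈ transversals R p, ∏ᶠ x, m (τ x) := by
  have hunion : transversals R p =
      ⋃ σ : X ≃ Y, univ.pi fun x => {d | p d = σ x ∧ R x d} := by
    ext τ
    simp only [mem_iUnion, mem_univ_pi]
    constructor
    · exact fun hτ => ⟨Equiv.ofBijective _ hτ.2, fun x => ⟨rfl, hτ.1 x⟩⟩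
    · rintro ⟨σ, hσ⟩
      refine ⟨fun x => (hσ x).2, ?_⟩
      rw [show p ∘ τ = σ from funext fun x => (hσ x).1]
      exact σ.bijective
  rw [hunion, finsum_mem_iUnion _ fun _ => toFinite _]
  · exact finsum_congr fun σ => finprod_finsum_mem _ _
  · intro σ σ' hne
    refine Set.disjoint_left.2 fun τ hτ hτ' => hne (Equiv.ext fun x => ?_)
    exact (hτ x trivial).1.symm.trans (hτ' x trivial).1

end Transversals

section TightSeparator

variable {V W : Type u} {G : SimpleGraph V} {H : SimpleGraph W} {F : V → V} {X : Set V}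

lemma exists_mem_perfectMaps_of_injective {j : X → V} (hj : Injective j)
    (hjX : Disjoint X (range j)) (hadj : ∀ x : X, G.Adj x (j x)) :
    ∃ T ∈ perfectMaps G (X ∪ range j), ∀ x : X, T x = j x := by
  classical
  let T (v : V) : V := if h : v ∈ X then j ⟨v, h⟩ else extend j Subtype.val id v
  have hTX (x : X) : T x = j x := dif_pos x.2
  have hTj (x : X) : T (j x) = x := by
    rw [← hj.extend_apply Subtype.val id x]
    exact dif_neg (hjX.notMem_of_mem_right ⟨x, rfl⟩)
  have hT {v : V} (hv : v ∉ X ∪ range j) : T v = v :=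
    (dif_neg fun h => hv (Or.inl h)).trans (extend_apply' _ _ _ fun h => hv (Or.inr h))
  have hcases (v : V) : (∃ x : X, v = x) ∨ (∃ x, v = j x) ∨ v ∉ X ∪ range j := by
    by_cases hv : v ∈ X ∪ range j
    · rcases hv with hv | ⟨x, rfl⟩
      exacts [Or.inl ⟨⟨v, hv⟩, rfl⟩, Or.inr (Or.inl ⟨x, rfl⟩)]
    · exact Or.inr (Or.inr hv)
  refine ⟨T, ⟨⟨fun v => ?_, fun v => ?_⟩, ?_⟩, hTX⟩
  · rcases hcases v with ⟨x, rfl⟩ | ⟨x, rfl⟩ | hv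
    exacts [by rw [hTX, hTj], by rw [hTj, hTX], by rw [hT hv, hT hv]]
  · rcases hcases v with ⟨x, rfl⟩ | ⟨x, rfl⟩ | hv
    exacts [Or.inr (hTX x ▸ hadj x), Or.inr ((hTj x).symm ▸ (hadj x).symm), Or.inl (hT hv)]
  · refine Subset.antisymm (fun v hv hmem => ?_) fun v hv => hT hv
    rcases hmem with hvX | ⟨x, rfl⟩
    · exact (hadj ⟨v, hvX⟩).ne (by rw [← hTX]; exact hv.symm)
    · exact (hadj x).ne (by rw [← hTj]; exact hv)

lemma ncard_perfectMaps_extending {j : X → V} (hj : Injective j) (hjX : Disjoint X (range j))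
    (hadj : ∀ x : X, G.Adj x (j x)) :
    {F ∈ perfectMaps G univ | ∀ x : X, F x = j x}.ncard =
      (perfectMaps G (X ∪ range j)ᶜ).ncard := by
  obtain ⟨T, hT, hTj⟩ := exists_mem_perfectMaps_of_injective hj hjX hadj
  rw [← ncard_perfectMaps_eqOn disjoint_compl_left hT, compl_union_self]
  congr 1
  ext F
  refine and_congr_right fun hF => ⟨fun h => ?_, fun h x => (h (Or.inl x.2)).trans (hTj x)⟩
  rintro v (hv | ⟨x, rfl⟩)
  · exact (h ⟨v, hv⟩).trans (hTj ⟨v, hv⟩).symm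
  · rw [← h x, hF.1.1, h x, ← hTj x, hT.1.1]

/-- The vertex set `X` separates the image of `H` from the rest of `G`, every perfect matching of
`G` matches `X` into the image of `H`, and it has exactly one edge between `X` and each component of
`H`. In the theorem, `H` is the graph on `D(G - u)` and `X` is `A(G - u) ∪ {u}`. -/
structure IsTightSeparator (e : H ↪g G) (X : Set V) : Prop where
  disjoint : Disjoint X (range e)
  mem_of_adj : ∀ w v, G.Adj (e w) v → v ∈ X ∪ range e
  mapsTo : ∀ F ∈ perfectMaps G univ, MapsTo F X (range e)
  existsUnique : ∀ F ∈ perfectMaps G univ, ∀ K : H.ConnectedComponent,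
    ∃! w, w ∈ K.supp ∧ F (e w) ∈ X

lemma numPM_induce (e : H ↪g G) (s : Set W) :
    numPM (H.induce s) = (perfectMaps G (e '' s)).ncard := by
  rw [numPM_eq_ncard_perfectMaps_range ((SimpleGraph.Embedding.induce s).trans e)]
  congr 2
  ext v
  simp

namespace IsTightSeparator

variable {e : H ↪g G} (h : IsTightSeparator e X)
include h

lemma exists_transversal (hF : F ∈ perfectMaps G univ) :
    ∃ τ ∈ transversals (fun (x : X) w => G.Adj x (e w)) H.connectedComponentMk,
      ∀ x : X, F x = e (τ x) := by
  choose τ hτ using fun x : X => h.mapsTo F hF x.2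
  have hFτ (x : X) : F (e (τ x)) = x := by rw [hτ, hF.1.1]
  have hne (v : V) : F v ≠ v := fun hv => hF.2.le hv trivial
  refine ⟨τ, ⟨fun x => ?_, fun x y hxy => ?_, fun K => ?_⟩, fun x => (hτ x).symm⟩
  · simpa only [hτ] using (hF.1.2 x).resolve_left (hne x)
  · have heq := (h.existsUnique F hF _).unique ⟨rfl, (hFτ x).symm ▸ x.2⟩
      ⟨hxy.symm, (hFτ y).symm ▸ y.2⟩
    exact Subtype.ext (by rw [← hFτ, heq, hFτ])
  · obtain ⟨w, ⟨rfl, hwX⟩, -⟩ := h.existsUnique F hF K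
    refine ⟨⟨F (e w), hwX⟩, congrArg _ (e.injective ?_)⟩
    rw [hτ, hF.1.1]

lemma compl_union_range {τ : X → W}
    (hτ : τ ∈ transversals (fun (x : X) w => G.Adj x (e w)) H.connectedComponentMk) :
    (X ∪ range (e ∘ τ))ᶜ =
      (X ∪ range e)ᶜ ∪ ⋃ x, e '' ((H.connectedComponentMk (τ x)).supp \ {τ x}) := by
  ext v
  by_cases hv : v ∈ range e
  · obtain ⟨w, rfl⟩ := hv
    have hX : e w ∉ X := h.disjoint.notMem_of_mem_right (mem_range_self w)
    have hiff : (∀ x, τ x ≠ w) ↔ ∃ x, H.connectedComponentMk w = H.connectedComponentMk (τ x) ∧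
        w ≠ τ x := by
      constructor
      · intro hw
        obtain ⟨x, hx⟩ := hτ.2.surjective (H.connectedComponentMk w)
        exact ⟨x, hx.symm, (hw x).symm⟩
      · rintro ⟨x, hx, hne⟩ y rfl
        exact hne (congrArg τ (hτ.2.injective hx))
    simpa [hX, e.injective.eq_iff] using hiff
  · have hnot (w : W) : e w ≠ v := fun hw => hv ⟨w, hw⟩
    simp [hnot]

variable [Finite V]

lemma ncard_perfectMaps_compl {τ : X → W}
    (hτ : τ ∈ transversals (fun (x : X) w => G.Adj x (e w)) H.connectedComponentMk) :
    (perfectMaps G (X ∪ range (e ∘ τ))ᶜ).ncard = (perfectMaps G (X ∪ range e)ᶜ).ncard *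
      ∏ᶠ x, numPM (H.induce ((H.connectedComponentMk (τ x)).supp \ {τ x})) := by
  cases nonempty_fintype X
  have hsupp {x y : X} {w : W} (hx : w ∈ (H.connectedComponentMk (τ x)).supp)
      (hy : w ∈ (H.connectedComponentMk (τ y)).supp) : x = y :=
    hτ.2.injective (hx.symm.trans hy)
  simp_rw [h.compl_union_range hτ, numPM_induce e, finprod_eq_prod_of_fintype]
  rw [ncard_perfectMaps_union, ← ncard_perfectMaps_biUnion]
  · simp
  · rintro x - y - hne
    refine Set.disjoint_left.2 ?_
    rintro _ ⟨w, hw, rfl⟩ ⟨w', hw', hww'⟩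
    exact hne (hsupp hw.1 (e.injective hww' ▸ hw'.1))
  · rintro x - y - hne _ ⟨w, hw, rfl⟩ _ ⟨w', hw', rfl⟩ hadj
    exact hne (hsupp (SimpleGraph.ConnectedComponent.mem_supp_of_adj_mem_supp _ hw.1
      (e.map_adj_iff.1 hadj)) hw'.1)
  · refine disjoint_iUnion_right.2 fun x => Set.disjoint_left.2 ?_
    rintro _ hv ⟨w, -, rfl⟩
    exact hv (Or.inr ⟨w, rfl⟩)
  · intro z hz y hy hadj
    obtain ⟨x, w, -, rfl⟩ := mem_iUnion.1 hy
    exact hz (h.mem_of_adj w z hadj.symm)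

lemma numPM_eq_finsum_mem_transversals :
    numPM G = ∑ᶠ τ ∈ transversals (fun (x : X) w => G.Adj x (e w)) H.connectedComponentMk,
      (perfectMaps G (X ∪ range (e ∘ τ))ᶜ).ncard := by
  have : Finite W := Finite.of_injective e e.injective
  have hunion : perfectMaps G univ =
      ⋃ τ ∈ transversals (fun (x : X) w => G.Adj x (e w)) H.connectedComponentMk,
        {F ∈ perfectMaps G univ | ∀ x : X, F x = e (τ x)} := by
    ext F
    simp only [mem_iUnion₂, mem_sep_iff, exists_and_left, exists_prop]
    exact ⟨fun hF => ⟨hF, h.exists_transversal hF⟩, And.left⟩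
  rw [numPM_eq_ncard_perfectMaps_univ, hunion,
    (toFinite _).ncard_biUnion (fun _ _ => toFinite _)]
  · refine finsum_mem_congr rfl fun τ hτ => ?_
    exact ncard_perfectMaps_extending (e.injective.comp hτ.2.injective.of_comp)
      (h.disjoint.mono_right (range_comp_subset_range τ e)) hτ.1
  · intro τ _ τ' _ hne
    refine Set.disjoint_left.2 fun F hF hF' => hne (funext fun x => e.injective ?_)
    exact (hF.2 x).symm.trans (hF'.2 x)

lemma numPM_mul_permanent {U : Type u} {K : SimpleGraph U} (c : K ↪g G)
    (hc : range c = (X ∪ range e)ᶜ) :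
    (numPM K : ℝ) * permanent (fun (x : X) C => ∑ᶠ (w) (_ : H.connectedComponentMk w = C ∧
      G.Adj x (e w)), (numPM (H.induce ((H.connectedComponentMk w).supp \ {w})) : ℝ)) =
      numPM G := by
  have : Finite W := Finite.of_injective e e.injective
  rw [permanent_finsum fun (x : X) w => G.Adj x (e w), h.numPM_eq_finsum_mem_transversals,
    numPM_eq_ncard_perfectMaps_range c, hc, finsum_mem_eq_finite_toFinset_sum _ (toFinite _),
    finsum_mem_eq_finite_toFinset_sum _ (toFinite _), Finset.mul_sum, Nat.cast_sum]
  refine Finset.sum_congr rfl fun τ hτ => ?_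
  cases nonempty_fintype X
  rw [h.ncard_perfectMaps_compl ((Finite.mem_toFinset _).1 hτ), finprod_eq_prod_of_fintype,
    finprod_eq_prod_of_fintype, Nat.cast_mul, Nat.cast_prod]

end IsTightSeparator

end TightSeparator

section DeleteVertex

variable {V : Type u} {G : SimpleGraph V} {u : V} {F : V → V}

open Classical in
/-- The matching that `F` induces on the graph with `u` deleted: the partner of `u` becomes
unmatched. -/
noncomputable def restrictDel (u : V) (F : V → V) (w : ({u}ᶜ : Set V)) : ({u}ᶜ : Set V) :=
  if h : F w = u then w else ⟨F w, h⟩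

lemma restrictDel_of_eq {w : ({u}ᶜ : Set V)} (h : F w = u) : restrictDel u F w = w := dif_pos h

lemma coe_restrictDel_of_ne {w : ({u}ᶜ : Set V)} (h : F w ≠ u) :
    (restrictDel u F w : V) = F w := by
  rw [restrictDel, dif_neg h]

lemma isMatchingMap_restrictDel (hF : IsMatchingMap G F) :
    IsMatchingMap (del G u) (restrictDel u F) := by
  refine ⟨fun w => ?_, fun w => ?_⟩ <;> by_cases h : F w = u
  · rw [restrictDel_of_eq h, restrictDel_of_eq h]
  · have hFF : F (restrictDel u F w) = w := by rw [coe_restrictDel_of_ne h, hF.1]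
    refine Subtype.ext ?_
    rw [coe_restrictDel_of_ne (by rw [hFF]; exact w.2), hFF]
  · exact Or.inl (restrictDel_of_eq h)
  · rw [Subtype.ext_iff, SimpleGraph.induce_adj, coe_restrictDel_of_ne h]
    exact hF.2 w

variable (hF : F ∈ perfectMaps G univ)
include hF

lemma apply_ne_of_mem_perfectMaps_univ (v : V) : F v ≠ v := fun hv => hF.2.le hv trivial

lemma restrictDel_eq_self_iff {w : ({u}ᶜ : Set V)} : restrictDel u F w = w ↔ F w = u := by
  refine ⟨fun h => ?_, restrictDel_of_eq⟩
  by_contra hne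
  exact apply_ne_of_mem_perfectMaps_univ hF w (by rw [← coe_restrictDel_of_ne hne, h])

variable [Finite V]

lemma isMaxMatchingMap_restrictDel : IsMaxMatchingMap (del G u) (restrictDel u F) := by
  have hmatch : IsMatchingMap (del G u) (restrictDel u F) := isMatchingMap_restrictDel hF.1
  have hfix : fixedPoints (restrictDel u F) = {⟨F u, apply_ne_of_mem_perfectMaps_univ hF u⟩} := by
    ext w
    rw [mem_fixedPoints, IsFixedPt, restrictDel_eq_self_iff hF, mem_singleton_iff,
      Subtype.ext_iff]
    exact hF.1.1.eq_iff
  refine ⟨hmatch, fun g hg => ?_⟩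
  have heven := even_ncard_fixedPoints_add hmatch.1 hg.1 (mapsTo_univ _ univ) (mapsTo_univ _ univ)
  rw [inter_univ, inter_univ, hfix, ncard_singleton] at heven
  rw [hfix, ncard_singleton]
  grind

lemma mem_geD_del_of_apply_eq {w : ({u}ᶜ : Set V)} (hw : F w = u) : w ∈ geD (del G u) :=
  mem_geD_iff.2 ⟨_, isMaxMatchingMap_restrictDel hF, restrictDel_of_eq hw⟩

omit [Finite V] in
lemma apply_mem_leftSide_iff {w : ({u}ᶜ : Set V)} :
    F w ∈ leftSide G u ↔ restrictDel u F w = w ∨ restrictDel u F w ∈ geA (del G u) := by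
  rw [restrictDel_eq_self_iff hF, leftSide, mem_insert_iff]
  by_cases h : F w = u
  · simp [h]
  · rw [← coe_restrictDel_of_ne h, Subtype.val_injective.mem_set_image]

omit hF [Finite V] in
lemma mem_leftSide_iff {w : ({u}ᶜ : Set V)} : (w : V) ∈ leftSide G u ↔ w ∈ geA (del G u) := by
  have hwu : (w : V) ≠ u := w.2
  simp [leftSide, hwu]

end DeleteVertex

section MainIdentity

variable {V : Type u} (G : SimpleGraph V) (u : V)

/-- The inclusion of `G[D(G - u)]` into `G`. -/
def dEmbedding : dGraph G u ↪g G :=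
  (SimpleGraph.Embedding.induce _).trans (SimpleGraph.Embedding.induce _)

/-- The inclusion of `G[C(G - u)]` into `G`. -/
def cEmbedding : cGraph G u ↪g G :=
  (SimpleGraph.Embedding.induce _).trans (SimpleGraph.Embedding.induce _)

variable {G u} in
lemma coe_mem_range_dEmbedding_iff {w : ({u}ᶜ : Set V)} :
    (w : V) ∈ range (dEmbedding G u) ↔ w ∈ geD (del G u) := by
  constructor
  · rintro ⟨d, hd⟩
    rw [← show d.1 = w from Subtype.ext hd]
    exact d.2
  · exact fun hw => ⟨⟨w, hw⟩, rfl⟩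

lemma range_cEmbedding : range (cEmbedding G u) = (leftSide G u ∪ range (dEmbedding G u))ᶜ := by
  ext v
  by_cases hv : v = u
  · subst hv
    refine iff_of_false ?_ fun h => h (Or.inl (mem_insert _ _))
    rintro ⟨c, hc⟩
    exact c.1.2 hc
  · lift v to ({u}ᶜ : Set V) using hv
    rw [mem_compl_iff, mem_union, mem_leftSide_iff, coe_mem_range_dEmbedding_iff, or_comm, not_or]
    constructor
    · rintro ⟨c, hc⟩
      rw [← show c.1 = v from Subtype.ext hc]
      exact c.2
    · exact fun hc => ⟨⟨v, hc⟩, rfl⟩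

variable [Finite V]

lemma isTightSeparator_leftSide : IsTightSeparator (dEmbedding G u) (leftSide G u) where
  disjoint := by
    rw [Set.disjoint_right]
    rintro _ ⟨d, rfl⟩ hd
    exact (mem_leftSide_iff.1 hd).1 d.2
  mem_of_adj d v hadj := by
    by_cases hv : v = u
    · exact Or.inl (Or.inl hv)
    lift v to ({u}ᶜ : Set V) using hv
    rw [mem_union, mem_leftSide_iff, coe_mem_range_dEmbedding_iff, or_iff_not_imp_right]
    exact fun hvD => ⟨hvD, d.1, d.2, hadj.symm⟩
  mapsTo F hF := by
    rintro x (hx | ⟨a, ha, rfl⟩)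
    · have hFx : F x ≠ u := hx ▸ apply_ne_of_mem_perfectMaps_univ hF x
      lift F x to ({u}ᶜ : Set V) using hFx with w hw
      exact coe_mem_range_dEmbedding_iff.2 (mem_geD_del_of_apply_eq hF (by rw [hw, hF.1.1, hx]))
    · have hFa : F a ≠ u := fun h => ha.1 (mem_geD_del_of_apply_eq hF h)
      rw [← coe_restrictDel_of_ne hFa, coe_mem_range_dEmbedding_iff]
      exact (isMaxMatchingMap_restrictDel hF).apply_mem_geD ha
  existsUnique F hF K := by
    have hiff (d : geD (del G u)) : F (dEmbedding G u d) ∈ leftSide G u ↔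
        restrictDel u F d = d ∨ restrictDel u F d ∈ geA (del G u) :=
      apply_mem_leftSide_iff hF
    simp_rw [hiff]
    exact (isMaxMatchingMap_restrictDel hF).existsUnique_exposed K

lemma numPM_cGraph_mul_permanent :
    (numPM (cGraph G u) : ℝ) * permanent (weight G u fun v => (numPM (hGraph G u v) : ℝ)) =
      numPM G :=
  (isTightSeparator_leftSide G u).numPM_mul_permanent (cEmbedding G u) (range_cEmbedding G u)

end MainIdentity

section ExpWithin

open Real

/-- A multiplicative form of `Within δ a z`, for which errors add up under products and nested
estimates. The constant `2 / 3` is small enough for `exp (2 / 3 * δ) ≤ 1 + δ` on `[0, 1]`. -/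
def ExpWithin (δ a z : ℝ) : Prop :=
  exp (-δ) * z ≤ a ∧ a ≤ exp (2 / 3 * δ) * z

variable {δ δ' ε a a' b z z' : ℝ}

lemma ExpWithin.refl (z : ℝ) : ExpWithin 0 z z := by
  simp [ExpWithin]

lemma ExpWithin.nonneg (h : ExpWithin δ a z) (hz : 0 ≤ z) : 0 ≤ a :=
  (mul_nonneg (exp_nonneg _) hz).trans h.1

lemma ExpWithin.mono (h : ExpWithin δ a z) (hz : 0 ≤ z) (hδ : δ ≤ δ') : ExpWithin δ' a z :=
  ⟨le_trans (by gcongr) h.1, h.2.trans (by gcongr)⟩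

lemma ExpWithin.trans (h : ExpWithin δ a b) (h' : ExpWithin δ' b z) : ExpWithin (δ + δ') a z := by
  constructor
  · calc exp (-(δ + δ')) * z = exp (-δ) * (exp (-δ') * z) := by
          rw [neg_add, exp_add, mul_assoc]
      _ ≤ exp (-δ) * b := by gcongr; exact h'.1
      _ ≤ a := h.1
  · calc a ≤ exp (2 / 3 * δ) * b := h.2
      _ ≤ exp (2 / 3 * δ) * (exp (2 / 3 * δ') * z) := by gcongr; exact h'.2
      _ = exp (2 / 3 * (δ + δ')) * z := by rw [mul_add, exp_add, mul_assoc]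

lemma ExpWithin.mul_right (h : ExpWithin δ a z) (hb : 0 ≤ b) : ExpWithin δ (a * b) (z * b) := by
  simp only [ExpWithin, ← mul_assoc]
  exact ⟨by gcongr; exact h.1, by gcongr; exact h.2⟩

lemma ExpWithin.mul (h : ExpWithin δ a z) (h' : ExpWithin δ' a' z') (hz : 0 ≤ z) (hz' : 0 ≤ z') :
    ExpWithin (δ + δ') (a * a') (z * z') := by
  refine (h.mul_right (h'.nonneg hz')).trans ?_
  simpa only [mul_comm z] using h'.mul_right hz

lemma ExpWithin.prod {ι : Type*} (s : Finset ι) {δ a z : ι → ℝ} (hz : ∀ i, 0 ≤ z i)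
    (h : ∀ i, ExpWithin (δ i) (a i) (z i)) :
    ExpWithin (∑ i ∈ s, δ i) (∏ i ∈ s, a i) (∏ i ∈ s, z i) := by
  classical
  induction s using Finset.induction_on with
  | empty => exact .refl 1
  | insert i s hi ih =>
    rw [Finset.sum_insert hi, Finset.prod_insert hi, Finset.prod_insert hi]
    exact (h i).mul ih (hz i) (Finset.prod_nonneg fun j _ => hz j)

lemma ExpWithin.sum {ι : Type*} (s : Finset ι) {a z : ι → ℝ}
    (h : ∀ i ∈ s, ExpWithin δ (a i) (z i)) : ExpWithin δ (∑ i ∈ s, a i) (∑ i ∈ s, z i) := by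
  simp only [ExpWithin, Finset.mul_sum]
  exact ⟨Finset.sum_le_sum fun i hi => (h i hi).1, Finset.sum_le_sum fun i hi => (h i hi).2⟩

lemma exp_two_thirds_mul_le (h0 : 0 ≤ ε) (h1 : ε ≤ 1) : exp (2 / 3 * ε) ≤ 1 + ε := by
  have hlog : 2 / 3 * ε ≤ log 2 * ε := by
    gcongr
    linarith [log_two_gt_d9]
  calc exp (2 / 3 * ε) ≤ exp (log 2 * ε) := exp_le_exp.2 hlog
    _ = (1 + 1) ^ ε := by rw [rpow_def_of_pos (by norm_num), one_add_one_eq_two]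
    _ ≤ 1 + ε * 1 := rpow_one_add_le_one_add_mul_self (by norm_num) h0 h1
    _ = 1 + ε := by rw [mul_one]

lemma ExpWithin.within (h : ExpWithin ε a z) (hz : 0 ≤ z) (h0 : 0 ≤ ε) (h1 : ε ≤ 1) :
    Within ε a z := by
  have hlow : 1 - ε ≤ exp (-ε) := one_sub_le_exp_neg ε
  have hup : exp (2 / 3 * ε) ≤ 1 + ε := exp_two_thirds_mul_le h0 h1
  exact ⟨le_trans (by gcongr) h.1, h.2.trans (by gcongr)⟩

lemma Within.expWithin (h : Within (ε / 3) a z) (hz : 0 ≤ z) (h0 : 0 ≤ ε) (h1 : ε ≤ 1) :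
    ExpWithin (ε / 2) a z := by
  have hlow : exp (-(ε / 2)) ≤ 1 - ε / 3 := by
    have hexp : ε / 2 + 1 ≤ exp (ε / 2) := add_one_le_exp _
    rw [exp_neg, inv_le_iff_one_le_mul₀ (exp_pos _)]
    nlinarith
  have hup : 1 + ε / 3 ≤ exp (2 / 3 * (ε / 2)) := by
    rw [show 2 / 3 * (ε / 2) = ε / 3 by ring, add_comm]
    exact add_one_le_exp _
  exact ⟨le_trans (by gcongr) h.1, h.2.trans (by gcongr)⟩

lemma ExpWithin.permanent_finsum {X D Y : Type u} [Finite X] [Finite D] {R : X → D → Prop}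
    {p : D → Y} {δ m z : D → ℝ} {η : ℝ} (hz : ∀ d, 0 ≤ z d) (h : ∀ d, ExpWithin (δ d) (m d) (z d))
    (hδ : ∀ τ ∈ transversals R p, ∑ᶠ x, δ (τ x) ≤ η) :
    ExpWithin η (permanent fun x y => ∑ᶠ (d) (_ : p d = y ∧ R x d), m d)
      (permanent fun x y => ∑ᶠ (d) (_ : p d = y ∧ R x d), z d) := by
  cases nonempty_fintype X
  rw [RecCount.permanent_finsum, RecCount.permanent_finsum,
    finsum_mem_eq_finite_toFinset_sum _ (toFinite _),
    finsum_mem_eq_finite_toFinset_sum _ (toFinite _)]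
  refine .sum _ fun τ hτ => ?_
  simp_rw [finsum_eq_sum_of_fintype, finprod_eq_prod_of_fintype] at hδ ⊢
  refine (ExpWithin.prod _ (fun x => hz (τ x)) fun x => h (τ x)).mono ?_ ?_
  · exact Finset.prod_nonneg fun x _ => hz (τ x)
  · exact hδ τ ((Finite.mem_toFinset _).1 hτ)

end ExpWithin

section Budget

variable {V W : Type u} [Finite V] {G : SimpleGraph V} {H : SimpleGraph W} {X : Set V}

lemma three_mul_ncard_nontrivial_le (e : H ↪g G) (hX : Disjoint X (range e)) {τ : X → W}
    (hτ : Injective (H.connectedComponentMk ∘ τ)) :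
    3 * {x | (H.connectedComponentMk (τ x)).supp.Nontrivial}.ncard ≤ Nat.card V := by
  set s : Set X := {x | (H.connectedComponentMk (τ x)).supp.Nontrivial}
  choose σ hσ hne using fun x : s => x.2.exists_ne (τ x)
  have hcomp {x y : s} (hxy : H.connectedComponentMk (τ x) = H.connectedComponentMk (τ y)) :
      x = y := Subtype.ext (hτ hxy)
  have hinj : Injective
      (Sum.elim (fun x : s => (x : V)) (e ∘ Sum.elim (fun x : s => τ x) σ)) := by
    refine (Subtype.val_injective.comp Subtype.val_injective).sumElim
      (e.injective.comp (Injective.sumElim ?_ ?_ ?_)) ?_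
    · exact fun x y hxy => hcomp (congrArg _ hxy)
    · exact fun x y hxy => hcomp ((hσ x).symm.trans (hxy ▸ hσ y))
    · intro x y hxy
      obtain rfl : x = y := hcomp (hxy ▸ hσ y)
      exact hne x hxy.symm
    · exact fun x y hxy => hX.notMem_of_mem_left x.1.2 ⟨_, hxy.symm⟩
  have hcard := Nat.card_le_card_of_injective _ hinj
  rw [Nat.card_sum, Nat.card_sum, Nat.card_coe_set_eq] at hcard
  omega

open Classical in
lemma finsum_ite_nontrivial_le (e : H ↪g G) (hX : Disjoint X (range e)) {τ : X → W}
    (hτ : Injective (H.connectedComponentMk ∘ τ)) {ε : ℝ} (hε : 0 ≤ ε) :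
    ∑ᶠ x, (if (H.connectedComponentMk (τ x)).supp.Nontrivial then ε / (2 * Nat.card V) else 0) ≤
      ε / 6 := by
  cases nonempty_fintype X
  have hcard : 3 * (({x | (H.connectedComponentMk (τ x)).supp.Nontrivial}.ncard : ℕ) : ℝ) ≤
      Nat.card V := by
    exact_mod_cast three_mul_ncard_nontrivial_le e hX hτ
  rw [ncard_eq_toFinset_card', toFinset_ofPred] at hcard
  rw [finsum_eq_sum_of_fintype, ← Finset.sum_filter, Finset.sum_const, nsmul_eq_mul,
    ← mul_div_assoc]
  refine div_le_of_le_mul₀ (by positivity) (by positivity) ?_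
  nlinarith

end Budget

section Algorithm

variable {V : Type u} {G : SimpleGraph V} {u : V} {m : geD (del G u) → ℝ} {ε r : ℝ}
  {P : Subroutine.{u}} {U : ChoiceRule.{u}}

open Classical in
lemma expWithin_permanent_weight [Finite V] (hε : 0 ≤ ε)
    (hm : ∀ v, ExpWithin
      (if ((dGraph G u).connectedComponentMk v).supp.Nontrivial then ε / (2 * Nat.card V) else 0)
      (m v) (numPM (hGraph G u v))) :
    ExpWithin (ε / 6) (permanent (weight G u m))
      (permanent (weight G u fun v => (numPM (hGraph G u v) : ℝ))) :=
  .permanent_finsum (fun _ => Nat.cast_nonneg _) hm fun _ hτ =>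
    finsum_ite_nontrivial_le (dEmbedding G u) (isTightSeparator_leftSide G u).disjoint
      hτ.2.injective hε

lemma permanent_nonneg {X Y : Type u} {w : X → Y → ℝ} (hw : ∀ x y, 0 ≤ w x y) :
    0 ≤ permanent w :=
  finsum_nonneg fun _ => finprod_nonneg fun _ => hw _ _

lemma weight_nonneg (hm : ∀ v, 0 ≤ m v) (x : leftSide G u) (H : rightSide G u) :
    0 ≤ weight G u m x H :=
  finsum_nonneg fun v => finsum_nonneg fun _ => hm v

lemma numPM_of_isEmpty [IsEmpty V] (G : SimpleGraph V) : numPM G = 1 := by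
  rw [numPM_eq_ncard_perfectMaps_univ, univ_eq_empty_iff.2 ‹_›, perfectMaps_empty, ncard_singleton]

lemma Returns.eq_one [hV : IsEmpty V] (h : Returns P U G ε r) : r = 1 := by
  cases h with
  | empty => rfl
  | step _ _ u => exact hV.elim u

lemma accuracy_div_mem_Ioc {n : ℕ} (hn : 0 < n) (hε : ε ∈ Ioc (0 : ℝ) 1) :
    ε / (2 * (n : ℝ)) ∈ Ioc (0 : ℝ) 1 := by
  have hn' : (1 : ℝ) ≤ n := by exact_mod_cast hn
  obtain ⟨h0, h1⟩ := hε
  refine ⟨by positivity, ?_⟩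
  rw [div_le_one (by positivity)]
  linarith

lemma accuracy_div_three_mem_Ioc (hε : ε ∈ Ioc (0 : ℝ) 1) : ε / 3 ∈ Ioc (0 : ℝ) 1 := by
  obtain ⟨h0, h1⟩ := hε
  constructor <;> linarith

open Classical in
lemma expWithin_ite_of_returns {v : geD (del G u)} (hv : Returns P U (hGraph G u v) ε r)
    (h : ExpWithin ε r (numPM (hGraph G u v))) :
    ExpWithin (if ((dGraph G u).connectedComponentMk v).supp.Nontrivial then ε else 0) r
      (numPM (hGraph G u v)) := by
  split_ifs with hK
  · exact h
  · rw [not_nontrivial_iff] at hK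
    have : IsEmpty ↥(((dGraph G u).connectedComponentMk v).supp \ {v}) :=
      ⟨fun w => w.2.2 (hK w.2.1 rfl)⟩
    rw [numPM_of_isEmpty, hv.eq_one, Nat.cast_one]
    exact .refl 1

/-- The estimate of the permanent to within `ε / 3` costs `ε / 2` in the exponential form, and the
weights cost only `ε / 6` in total, which leaves `ε / 3` for the call on `C(G - u)`. -/
lemma expWithin_mul_of_mem_subroutine [Finite V] (hP : P.ComputesPermanent)
    (hε : ε ∈ Ioc (0 : ℝ) 1) {mC p : ℝ}
    (hm : ∀ v, Returns P U (hGraph G u v) (ε / (2 * Nat.card V)) (m v))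
    (hm' : ∀ v, ExpWithin (ε / (2 * Nat.card V)) (m v) (numPM (hGraph G u v)))
    (hC : ExpWithin (ε / 3) mC (numPM (cGraph G u)))
    (hp : p ∈ P (leftSide G u) (rightSide G u) (weight G u m) (ε / 3)) :
    ExpWithin ε (mC * p) (numPM G) := by
  have hm0 (v) : 0 ≤ m v := (hm' v).nonneg (Nat.cast_nonneg _)
  have hδ := accuracy_div_three_mem_Ioc hε
  have hper : ExpWithin (ε / 2) p (permanent (weight G u m)) :=
    ((hP _ _ _ _ (weight_nonneg hm0) hδ.1 hδ.2).2 p hp).expWithin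
      (permanent_nonneg (weight_nonneg hm0)) hε.1.le hε.2
  have hweight : ExpWithin (ε / 6) (permanent (weight G u m))
      (permanent (weight G u fun v => (numPM (hGraph G u v) : ℝ))) :=
    expWithin_permanent_weight hε.1.le fun v => expWithin_ite_of_returns (hm v) (hm' v)
  rw [← numPM_cGraph_mul_permanent G u, show ε = ε / 3 + (ε / 2 + ε / 6) by ring]
  exact hC.mul (hper.trans hweight) (Nat.cast_nonneg _)
    (permanent_nonneg (weight_nonneg fun v => Nat.cast_nonneg _))

lemma Returns.expWithin (hP : P.ComputesPermanent) (h : Returns P U G ε r) [hV : Finite V]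
    (hε : ε ∈ Ioc (0 : ℝ) 1) : ExpWithin ε r (numPM G) := by
  revert hV hε
  induction h with
  | empty G ε =>
    intro _ hε
    rw [numPM_of_isEmpty, Nat.cast_one]
    exact (ExpWithin.refl 1).mono zero_le_one hε.1.le
  | @step V G ε u _ m hm mC _ p hp ihm ihC =>
    intro _ hε
    have : Nonempty V := ⟨u⟩
    exact expWithin_mul_of_mem_subroutine hP hε hm
      (fun v => ihm v (accuracy_div_mem_Ioc Nat.card_pos hε))
      (ihC (accuracy_div_three_mem_Ioc hε)) hp

lemma card_lt_of_subset_compl_singleton [Finite V] (s : Set ({u}ᶜ : Set V)) :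
    Nat.card s < Nat.card V := by
  refine (Nat.card_le_card_of_injective _ Subtype.val_injective).trans_lt ?_
  rw [Nat.card_coe_set_eq]
  exact ncard_lt_card (by simp)

lemma exists_returns [Finite V] (hP : P.ComputesPermanent) (hU : U.Total) (G : SimpleGraph V)
    (hε : ε ∈ Ioc (0 : ℝ) 1) : ∃ r, Returns P U G ε r := by
  induction hn : Nat.card V using Nat.strong_induction_on generalizing V ε with
  | _ n ih =>
    subst hn
    rcases isEmpty_or_nonempty V with hV | hV
    · exact ⟨1, .empty G ε⟩
    obtain ⟨u, hu⟩ := hU V G ε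
    have hδ := accuracy_div_mem_Ioc (Nat.card_pos (α := V)) hε
    have hδ' := accuracy_div_three_mem_Ioc hε
    have hcard (v) : Nat.card ↥(((dGraph G u).connectedComponentMk v).supp \ {v}) < Nat.card V :=
      (Nat.card_le_card_of_injective _ Subtype.val_injective).trans_lt
        (card_lt_of_subset_compl_singleton _)
    choose m hm using fun v => ih _ (hcard v) (hGraph G u v) hδ rfl
    obtain ⟨mC, hC⟩ := ih _ (card_lt_of_subset_compl_singleton _) (cGraph G u) hδ' rfl
    have hm0 (v) : 0 ≤ m v := ((hm v).expWithin hP hδ).nonneg (Nat.cast_nonneg _)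
    obtain ⟨p, hp⟩ := (hP _ _ _ _ (weight_nonneg hm0) hδ'.1 hδ'.2).1
    exact ⟨_, .step G ε u hu m hm mC hC p hp⟩

end Algorithm

end RecCount

theorem theorem3 {V : Type u} [Finite V] (G : SimpleGraph V) :
    (∀ u : V,
      (RecCount.numPM (RecCount.cGraph G u) : ℝ) *
          RecCount.permanent
            (RecCount.weight G u fun v => (RecCount.numPM (RecCount.hGraph G u v) : ℝ)) =
        (RecCount.numPM G : ℝ)) ∧
    ∀ (P : RecCount.Subroutine.{u}) (U : RecCount.ChoiceRule.{u}),
      P.ComputesPermanent → U.Total →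
      ∀ ε : ℝ, 0 < ε → ε ≤ 1 →
        (∃ r : ℝ, RecCount.Returns P U G ε r) ∧
        ∀ r : ℝ, RecCount.Returns P U G ε r → RecCount.Within ε r (RecCount.numPM G : ℝ) := by
  refine ⟨fun u => RecCount.numPM_cGraph_mul_permanent G u, fun P U hP hU ε h0 h1 =>
    ⟨RecCount.exists_returns hP hU G ⟨h0, h1⟩, fun r hr => ?_⟩⟩
  exact (hr.expWithin hP ⟨h0, h1⟩).within (Nat.cast_nonneg _) h0.le h1
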